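/- Consider the discrete-time plant $x_{t+1}=f(x_t,u_t)$, $y_t=g(x_t,u_t)$ with $x_t\in\mathbb R^{m}$ and $u_t,y_t\in\mathbb R^{n}$, and a cost $\mathcal J:\mathbb R^n\to\mathbb R$. All vector norms are Euclidean. *Comparison functions and ISS.* A function $\alpha:[0,\infty)\to[0,\infty)$ is class-$\mathcal K$ if it is continuous, strictly increasing and $\alpha(0)=0$; it is class-$\mathcal K_\infty$ if moreover $\alpha(s)\to\infty$ as $s\to\infty$. A function $\beta:[0,\infty)^2\to[0,\infty)$ is class-$\mathcal{KL}$ if $\beta(\cdot,t)$ is class-$\mathcal K$ for every $t\ge 0$ and, for every $s>0$, $\beta(s,\cdot)$ is continuous and strictly decreasing with $\beta(s,t)\to0$ as $t\to\infty$. A point $\bar z$ is input-to-state stable (ISS) for a system $z_{t+1}=F(z_t,d_t)$ if there are $\beta\in\mathcal{KL}$ and $\sigma\in\mathcal K$ such that $\|z_t-\bar z\|\le\beta(\|z_0-\bar z\|,t)+\sigma(\sup_s\|d_s\|)$ for all $t\in\mathbb N$, all initial states $z_0$ and all bounded inputs $d$. *Plant assumptions.* The maps $f$, $g$ are Lipschitz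 continuous, and there is a Lipschitz map $\pi:\mathbb R^n\to\mathbb R^m$ such that, for each $u$, $\pi(u)$ is the unique equilibrium $f(\pi(u),u)=\pi(u)$ for the constant input $u$, and $\pi(u)$ is ISS for the perturbed-input system $x_{t+1}=f(x_t,u+d_t)$. For each constant input $u_t=\bar r$ and each initial state, $y_t\to\bar r$. *Optimal equilibrium.* $(\bar y^\star,\bar u^\star,\bar x^\star)$ minimizes $\mathcal J(\bar y)$ subject to $\bar x=f(\bar x,\bar u)$, $\bar y=g(\bar x,\bar u)$. *Cost assumptions.* $\mathcal J$ is $\mathcal C^2$; there are matrices $\underline H,\bar H$ with $\underline H\preceq\nabla^2\mathcal J(y)\preceq\bar H$ for all $y$; and there are class-$\mathcal K_\infty$ functions $\kappa_1,\kappa_2,\kappa_3$ such that, for all $y$, $\kappa_1(\|y-\bar y^\star\|)\le\mathcal J(y)-\mathcal J(\bar y^\star)\le\kappa_2(\|y-\bar y^\star\|)$ and $\|\nabla\mathcal J(y)\|\ge\kappa_3(\|y-\bar y^\star\|)$. *Controller.* The integral extremum seeking controller has state $r_t\in\mathbb R^n$, input $u_t=r_t+d_t$ with dither $d_t$, and update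 $r_{t+1}=r_t-\alpha_tK\hat\theta_t$ if $\alpha_t\ge\underline\alpha$ and $r_{t+1}=r_t$ otherwise, where the threshold satisfies $\underline\alpha\le1$. **Proposition.** Let the plant and cost assumptions hold, and let the gain $K=K^\top\succ0$ satisfy $$K-K(\bar H+\gamma I)K\succeq0$$ for some scalar $\gamma\ge0$. Then, with the perfect gradient estimate $\hat\theta_t=\nabla\mathcal J(r_t)$ and the step-size $\alpha_t=1$, the point $(\bar x^\star,\bar u^\star)$ is ISS, with respect to the dither $d_t$, for the closed-loop system with state $(x_t,r_t)$, $$x_{t+1}=f(x_t,r_t+d_t),\qquad r_{t+1}=r_t-K\nabla\mathcal J(r_t).$$ -/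

import Mathlib

open scoped NNReal Topology

/-- Class-`𝓚` functions `[0,∞) → [0,∞)`: continuous, strictly increasing, zero at zero. -/
def ClassK (α : ℝ≥0 → ℝ≥0) : Prop :=
  Continuous α ∧ StrictMono α ∧ α 0 = 0

/-- Class-`𝓚∞` functions: class-`𝓚` and unbounded. -/
def ClassKInf (α : ℝ≥0 → ℝ≥0) : Prop :=
  ClassK α ∧ Filter.Tendsto α Filter.atTop Filter.atTop

/-- Class-`𝓚𝓛` functions `[0,∞)² → [0,∞)`: class-`𝓚` in the first argument, and, for a positive
first argument, continuous and strictly decreasing to zero in the second. -/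
def ClassKL (β : ℝ≥0 → ℝ≥0 → ℝ≥0) : Prop :=
  (∀ t, ClassK (fun s => β s t)) ∧
  ∀ s, 0 < s → Continuous (β s) ∧ StrictAnti (β s) ∧ Filter.Tendsto (β s) Filter.atTop (𝓝 0)

/-- The point `xe` is (globally) input-to-state stable for the discrete-time system
`x (t+1) = F (x t) (d t)` with bounded input `d`. -/
def IsISS {X D : Type*} [NormedAddCommGroup X] [NormedAddCommGroup D]
    (F : X → D → X) (xe : X) : Prop :=
  ∃ (β : ℝ≥0 → ℝ≥0 → ℝ≥0) (γ : ℝ≥0 → ℝ≥0), ClassKL β ∧ ClassK γ ∧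
    ∀ (x : ℕ → X) (d : ℕ → D), (∀ t, x (t + 1) = F (x t) (d t)) →
      BddAbove (Set.range fun t => ‖d t‖₊) →
        ∀ t : ℕ, ‖x t - xe‖₊ ≤ β ‖x 0 - xe‖₊ (t : ℝ≥0) + γ (⨆ s, ‖d s‖₊)

/-- Assumptions on the plant `x⁺ = f x u`, `y = g x u` with steady-state map `π`. -/
structure PlantAssumption {m n : ℕ}
    (f : EuclideanSpace ℝ (Fin m) → EuclideanSpace ℝ (Fin n) → EuclideanSpace ℝ (Fin m))
    (g : EuclideanSpace ℝ (Fin m) → EuclideanSpace ℝ (Fin n) → EuclideanSpace ℝ (Fin n))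
    (π : EuclideanSpace ℝ (Fin n) → EuclideanSpace ℝ (Fin m)) : Prop where
  lipschitz_f : ∃ L : ℝ≥0, LipschitzWith L (Function.uncurry f)
  lipschitz_g : ∃ L : ℝ≥0, LipschitzWith L (Function.uncurry g)
  lipschitz_π : ∃ L : ℝ≥0, LipschitzWith L π
  equilibrium : ∀ u, f (π u) u = π u
  unique : ∀ u x, f x u = x → x = π u
  /-- Each equilibrium `π u` is input-to-state stable with respect to perturbations of the
  constant input `u`. -/
  iss : ∀ u, IsISS (fun x d => f x (u + d)) (π u)
  /-- The output tracks constant inputs. -/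
  tracking : ∀ (u : EuclideanSpace ℝ (Fin n)) (x : ℕ → EuclideanSpace ℝ (Fin m)),
    (∀ t, x (t + 1) = f (x t) u) → Filter.Tendsto (fun t => g (x t) u) Filter.atTop (𝓝 u)

/-- The Hessian matrix of `J` at `y`: the Jacobian matrix of the gradient of `J`. -/
noncomputable def hessianMatrix {n : ℕ} (J : EuclideanSpace ℝ (Fin n) → ℝ)
    (y : EuclideanSpace ℝ (Fin n)) : Matrix (Fin n) (Fin n) ℝ :=
  Matrix.of fun i j => (fderiv ℝ (gradient J) y (EuclideanSpace.single j 1)) i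

/-- Assumptions on the cost `J` with curvature bounds `Hlow`, `Hup` and optimal output `ystar`. -/
structure CostAssumption {n : ℕ} (J : EuclideanSpace ℝ (Fin n) → ℝ)
    (Hlow Hup : Matrix (Fin n) (Fin n) ℝ) (ystar : EuclideanSpace ℝ (Fin n)) : Prop where
  contDiff : ContDiff ℝ 2 J
  curvature_lower : ∀ y, (hessianMatrix J y - Hlow).PosSemidef
  curvature_upper : ∀ y, (Hup - hessianMatrix J y).PosSemidef
  bounds : ∃ κ₁ κ₂ : ℝ≥0 → ℝ≥0, ClassKInf κ₁ ∧ ClassKInf κ₂ ∧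
    ∀ y, (κ₁ ‖y - ystar‖₊ : ℝ) ≤ J y - J ystar ∧ J y - J ystar ≤ (κ₂ ‖y - ystar‖₊ : ℝ)
  gradient_bound : ∃ κ₃ : ℝ≥0 → ℝ≥0, ClassKInf κ₃ ∧
    ∀ y, κ₃ ‖y - ystar‖₊ ≤ ‖gradient J y‖₊

/-- `(y, u, x)` minimizes the cost `J y` over all equilibria `x = f x u`, `y = g x u`. -/
def IsOptimalEquilibrium {X U Y : Type*} (f : X → U → X) (g : X → U → Y) (J : Y → ℝ)
    (y : Y) (u : U) (x : X) : Prop :=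
  x = f x u ∧ y = g x u ∧ ∀ y' u' x', x' = f x' u' → y' = g x' u' → J y ≤ J y'

/-- The controller update `r⁺` for the gradient estimate `θ`, the step-size `α`, the gain `K`
and the step-size threshold `αmin`. -/
noncomputable def controllerStep {n : ℕ} (αmin α : ℝ) (K : Matrix (Fin n) (Fin n) ℝ)
    (θ r : EuclideanSpace ℝ (Fin n)) : EuclideanSpace ℝ (Fin n) :=
  r + if αmin ≤ α then -(α • WithLp.toLp 2 (K.mulVec θ.ofLp)) else 0

/-- The closed loop of the plant, driven by `u = r + d`, and the controller with step-size `1` and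
perfect gradient estimate. Its state is `(x, r)` (with the Euclidean norm), its input is the
dither `d`. -/
noncomputable def closedLoop {m n : ℕ}
    (f : EuclideanSpace ℝ (Fin m) → EuclideanSpace ℝ (Fin n) → EuclideanSpace ℝ (Fin m))
    (J : EuclideanSpace ℝ (Fin n) → ℝ) (αmin : ℝ) (K : Matrix (Fin n) (Fin n) ℝ)
    (z : WithLp 2 (EuclideanSpace ℝ (Fin m) × EuclideanSpace ℝ (Fin n)))
    (d : EuclideanSpace ℝ (Fin n)) :
    WithLp 2 (EuclideanSpace ℝ (Fin m) × EuclideanSpace ℝ (Fin n)) :=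
  WithLp.toLp 2 (f z.fst (z.snd + d), controllerStep αmin 1 K (gradient J z.snd) z.snd)

/-! The closed loop is a cascade: `r` evolves autonomously, and the dither enters only the plant,
whose input is `r + d`. Write `w` for the gradient at `r`. Taylor's formula along the step `-K w`
bounds the change of `J` by `-wᵀKw + ½ wᵀK Hup K w ≤ -½ wᵀKw`, because the gain condition with `γ ≥
0` gives `K Hup K ⪯ K` (`cost_controllerStep_le`). As `K ≻ 0` and the gradient is bounded below, `J
- J ystar` is a Lyapunov function for `r` (`exists_isLyapunovAlong`), so `r` is stable and uniformly
attracted to `ustar = ystar`. The plant is ISS about `π ustar = xstar` with respect to `r + d -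
ustar`, and the two facts combine in `IsISS.cascade`.

No explicit class-`𝓚𝓛` function is computed. Boundedness, stability and uniform attractivity, all
with one common gain, suffice (`IsISS.of_stable_of_attractive`): the supremum, over all trajectories
from a ball and all late times, of the excess over the gain is monotone in the radius, antitone in
time and has the right limits, and `exists_classKL_bound` majorizes it by a class-`𝓚𝓛` function. -/

/-! ### Continuous class-`𝓚𝓛` majorants. -/

/-- The truncation of a real number to `[0, 1]`. -/
noncomputable def clamp (x : ℝ) : ℝ := max 0 (min 1 x)

lemma clamp_nonneg (x : ℝ) : 0 ≤ clamp x := le_max_left _ _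

lemma clamp_le_one (x : ℝ) : clamp x ≤ 1 := max_le zero_le_one (min_le_left _ _)

lemma clamp_mono : Monotone clamp := fun _ _ h => max_le_max le_rfl (min_le_min le_rfl h)

lemma clamp_of_nonpos {x : ℝ} (h : x ≤ 0) : clamp x = 0 :=
  max_eq_left ((min_le_right _ _).trans h)

lemma clamp_of_one_le {x : ℝ} (h : 1 ≤ x) : clamp x = 1 := by
  rw [clamp, min_eq_left h, max_eq_right zero_le_one]

lemma abs_clamp_sub_clamp_le (x y : ℝ) : |clamp x - clamp y| ≤ |x - y| := by
  refine (abs_max_sub_max_le_max _ _ _ _).trans ?_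
  rw [sub_self, abs_zero, max_eq_right (abs_nonneg _)]
  refine (abs_min_sub_min_le_max _ _ _ _).trans ?_
  rw [sub_self, abs_zero, max_eq_right (abs_nonneg _)]

lemma abs_ciSup_sub_ciSup_le {ι : Type*} [Nonempty ι] {f g : ι → ℝ} {C : ℝ}
    (hf : BddAbove (Set.range f)) (hg : BddAbove (Set.range g))
    (h : ∀ i, |f i - g i| ≤ C) : |(⨆ i, f i) - ⨆ i, g i| ≤ C := by
  rw [abs_sub_le_iff]
  constructor
  · rw [sub_le_iff_le_add]
    exact ciSup_le fun i => by linarith [le_ciSup hg i, (abs_sub_le_iff.1 (h i)).1]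
  · rw [sub_le_iff_le_add]
    exact ciSup_le fun i => by linarith [le_ciSup hf i, (abs_sub_le_iff.1 (h i)).2]

section Envelope

variable (φ : ℝ≥0 → ℕ → ℝ≥0)

/-- The building blocks of `envelope`: the value `φ p.1 p.2`, faded out for `s ≤ p.1 / 2` and
for `t ≥ p.2 + 1`. -/
noncomputable def envelopeTerm (s t : ℝ≥0) (p : ℝ≥0 × ℕ) : ℝ :=
  φ p.1 p.2 * (clamp ((2 * s - p.1) / s) * clamp (p.2 + 1 - t))

/-- A continuous majorant of a function that is monotone in the first argument and antitone in
the second. -/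
noncomputable def envelope (s t : ℝ≥0) : ℝ := ⨆ p, envelopeTerm φ s t p

variable {φ}

lemma envelopeTerm_nonneg (s t : ℝ≥0) (p : ℝ≥0 × ℕ) : 0 ≤ envelopeTerm φ s t p :=
  mul_nonneg (NNReal.coe_nonneg _) (mul_nonneg (clamp_nonneg _) (clamp_nonneg _))

lemma envelope_nonneg (s t : ℝ≥0) : 0 ≤ envelope φ s t :=
  Real.iSup_nonneg fun p => envelopeTerm_nonneg s t p

/-- A term can be nonzero only if `p.1 < 2 * s` and `p.2 + 1 > t`, and the latter forces `p.2 ≥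
⌊t⌋₊`. -/
lemma envelopeTerm_le (hs : ∀ n, Monotone fun s => φ s n) (ht : ∀ s, Antitone (φ s))
    (s t : ℝ≥0) (p : ℝ≥0 × ℕ) : envelopeTerm φ s t p ≤ φ (2 * s) ⌊t⌋₊ := by
  rcases le_or_gt (2 * s) p.1 with h | h
  · have : ((2 * s - p.1) / s : ℝ) ≤ 0 :=
      div_nonpos_of_nonpos_of_nonneg (by have : (2 * s : ℝ) ≤ p.1 := by exact_mod_cast h
                                         linarith) s.2
    simp [envelopeTerm, clamp_of_nonpos this]
  rcases lt_or_ge p.2 ⌊t⌋₊ with h' | h'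
  · have h2 : ((p.2 + 1 : ℕ) : ℝ≥0) ≤ t := (Nat.le_floor_iff t.2).1 h'
    have : (p.2 + 1 - t : ℝ) ≤ 0 := by
      have : ((p.2 + 1 : ℕ) : ℝ) ≤ t := by exact_mod_cast h2
      push_cast at this
      linarith
    simp [envelopeTerm, clamp_of_nonpos this]
  · have h1 : (φ p.1 p.2 : ℝ) ≤ φ (2 * s) ⌊t⌋₊ := by
      exact_mod_cast (hs _ h.le).trans (ht _ h')
    refine (mul_le_of_le_one_right (NNReal.coe_nonneg _) ?_).trans h1
    exact mul_le_one₀ (clamp_le_one _) (clamp_nonneg _) (clamp_le_one _)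

lemma bddAbove_envelopeTerm (hs : ∀ n, Monotone fun s => φ s n) (ht : ∀ s, Antitone (φ s))
    (s t : ℝ≥0) : BddAbove (Set.range (envelopeTerm φ s t)) :=
  ⟨_, by rintro _ ⟨p, rfl⟩; exact envelopeTerm_le hs ht s t p⟩

lemma envelope_le (hs : ∀ n, Monotone fun s => φ s n) (ht : ∀ s, Antitone (φ s))
    (s t : ℝ≥0) : envelope φ s t ≤ φ (2 * s) ⌊t⌋₊ :=
  ciSup_le fun p => envelopeTerm_le hs ht s t p

lemma le_envelope (hs : ∀ n, Monotone fun s => φ s n) (ht : ∀ s, Antitone (φ s))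
    {s : ℝ≥0} (h0 : 0 < s) (n : ℕ) : (φ s n : ℝ) ≤ envelope φ s n := by
  have h0' : (s : ℝ) ≠ 0 := by exact_mod_cast h0.ne'
  have h1 : ((2 * s - s) / s : ℝ) = 1 := by field_simp; ring
  have h2 : ((n : ℝ) + 1 - ((n : ℝ≥0) : ℝ)) = 1 := by simp
  have : envelopeTerm φ s n (s, n) = φ s n := by
    simp only [envelopeTerm, h1, h2, clamp_of_one_le le_rfl, mul_one]
  rw [← this]
  exact le_ciSup (bddAbove_envelopeTerm hs ht s n) (s, n)

lemma envelope_mono (hs : ∀ n, Monotone fun s => φ s n) (ht : ∀ s, Antitone (φ s))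
    (t : ℝ≥0) : Monotone fun s => envelope φ s t := by
  intro s s' h
  rcases eq_or_lt_of_le (zero_le : 0 ≤ s) with rfl | h0
  -- At `s = 0` division by zero gives `0`, so every weight is `clamp 0 = 0`.
  · refine (ciSup_le fun p => ?_).trans (envelope_nonneg s' t)
    simp [envelopeTerm, clamp_of_nonpos]
  refine ciSup_mono (bddAbove_envelopeTerm hs ht s' t) fun p => ?_
  refine mul_le_mul_of_nonneg_left ?_ (NNReal.coe_nonneg _)
  refine mul_le_mul_of_nonneg_right (clamp_mono ?_) (clamp_nonneg _)
  have h0' : (0 : ℝ) < s := by exact_mod_cast h0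
  have h' : (s : ℝ) ≤ s' := by exact_mod_cast h
  rw [sub_div, sub_div, mul_div_cancel_right₀ _ h0'.ne',
    mul_div_cancel_right₀ _ (h0'.trans_le h').ne']
  linarith [div_le_div_of_nonneg_left (NNReal.coe_nonneg p.1) h0' h']

lemma envelope_anti (hs : ∀ n, Monotone fun s => φ s n) (ht : ∀ s, Antitone (φ s))
    (s : ℝ≥0) : Antitone (envelope φ s) := by
  intro t t' h
  refine ciSup_mono (bddAbove_envelopeTerm hs ht s t) fun p => ?_
  refine mul_le_mul_of_nonneg_left ?_ (NNReal.coe_nonneg _)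
  refine mul_le_mul_of_nonneg_left (clamp_mono ?_) (clamp_nonneg _)
  have h' : (t : ℝ) ≤ t' := by exact_mod_cast h
  linarith

lemma continuous_envelope_right (hs : ∀ n, Monotone fun s => φ s n) (ht : ∀ s, Antitone (φ s))
    (s : ℝ≥0) : Continuous (envelope φ s) := by
  refine (LipschitzWith.of_dist_le_mul (K := φ (2 * s) 0) fun t t' => ?_).continuous
  rw [Real.dist_eq, NNReal.dist_eq]
  refine abs_ciSup_sub_ciSup_le (bddAbove_envelopeTerm hs ht s t)
    (bddAbove_envelopeTerm hs ht s t') fun p => ?_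
  have key : |clamp (p.2 + 1 - t) - clamp (p.2 + 1 - t')| ≤ |(t : ℝ) - t'| := by
    refine (abs_clamp_sub_clamp_le _ _).trans_eq ?_
    rw [abs_sub_comm]
    congr 1
    ring
  have h0 : (φ p.1 p.2 * clamp ((2 * s - p.1) / s) : ℝ) ≤ φ (2 * s) 0 := by
    rcases le_or_gt (2 * s) p.1 with h | h
    · have : ((2 * s - p.1) / s : ℝ) ≤ 0 :=
        div_nonpos_of_nonpos_of_nonneg (by have : (2 * s : ℝ) ≤ p.1 := by exact_mod_cast h
                                           linarith) s.2
      simp [clamp_of_nonpos this]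
    · refine (mul_le_of_le_one_right (NNReal.coe_nonneg _) (clamp_le_one _)).trans ?_
      exact_mod_cast (hs _ h.le).trans (ht _ (Nat.zero_le _))
  have : envelopeTerm φ s t p - envelopeTerm φ s t' p = (φ p.1 p.2 * clamp ((2 * s - p.1) / s)) *
      (clamp (p.2 + 1 - t) - clamp (p.2 + 1 - t')) := by
    simp only [envelopeTerm]; ring
  rw [this, abs_mul, abs_of_nonneg (mul_nonneg (NNReal.coe_nonneg _) (clamp_nonneg _))]
  exact mul_le_mul h0 key (abs_nonneg _) (NNReal.coe_nonneg _)

/-- The weight `clamp (2 - p.1 / s)` is Lipschitz in `1 / s` with constant `p.1`. Only `p.1 < 2 * M`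
contributes, which makes the estimate uniform in `p`. -/
lemma abs_envelope_sub_le (hs : ∀ n, Monotone fun s => φ s n) (ht : ∀ s, Antitone (φ s))
    (t : ℝ≥0) {s s' M : ℝ≥0} (h0 : 0 < s) (h0' : 0 < s') (hM : s ≤ M) (hM' : s' ≤ M) :
    |envelope φ s t - envelope φ s' t| ≤ φ (2 * M) 0 * (2 * M * |(s : ℝ)⁻¹ - (s' : ℝ)⁻¹|) := by
  have h0r : (0 : ℝ) < s := by exact_mod_cast h0
  have h0r' : (0 : ℝ) < s' := by exact_mod_cast h0'
  refine abs_ciSup_sub_ciSup_le (bddAbove_envelopeTerm hs ht s t)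
    (bddAbove_envelopeTerm hs ht s' t) fun p => ?_
  have : envelopeTerm φ s t p - envelopeTerm φ s' t p = φ p.1 p.2 *
      (clamp (2 - p.1 * (s : ℝ)⁻¹) - clamp (2 - p.1 * (s' : ℝ)⁻¹)) * clamp (p.2 + 1 - t) := by
    have e : ∀ r : ℝ, 0 < r → (2 * r - p.1) / r = 2 - p.1 * r⁻¹ := fun r hr => by
      field_simp
    simp only [envelopeTerm, e _ h0r, e _ h0r']; ring
  rw [this, abs_mul, abs_of_nonneg (clamp_nonneg _)]
  refine (mul_le_of_le_one_right (abs_nonneg _) (clamp_le_one _)).trans ?_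
  rw [abs_mul, NNReal.abs_eq]
  rcases le_or_gt (2 * M) p.1 with h | h
  · have e : ∀ r : ℝ≥0, 0 < r → r ≤ M → clamp (2 - p.1 * (r : ℝ)⁻¹) = 0 := by
      intro r hr hrM
      apply clamp_of_nonpos
      have h1 : (2 * r : ℝ) ≤ p.1 := by
        exact_mod_cast (mul_le_mul_right hrM 2).trans h
      have hr' : (0 : ℝ) < r := by exact_mod_cast hr
      rw [sub_nonpos, ← div_eq_mul_inv, le_div_iff₀ hr']
      exact h1
    rw [e s h0 hM, e s' h0' hM', sub_self, abs_zero, mul_zero]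
    positivity
  · have h1 : (φ p.1 p.2 : ℝ) ≤ φ (2 * M) 0 := by
      exact_mod_cast (hs _ h.le).trans (ht _ (Nat.zero_le _))
    refine mul_le_mul h1 ?_ (abs_nonneg _) (NNReal.coe_nonneg _)
    refine (abs_clamp_sub_clamp_le _ _).trans ?_
    have : (2 - p.1 * (s : ℝ)⁻¹ - (2 - p.1 * (s' : ℝ)⁻¹)) = -(p.1 * ((s : ℝ)⁻¹ - (s' : ℝ)⁻¹)) := by
      ring
    rw [this, abs_neg, abs_mul, NNReal.abs_eq]
    refine mul_le_mul_of_nonneg_right ?_ (abs_nonneg _)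
    exact_mod_cast h.le

lemma continuous_envelope_left (hs : ∀ n, Monotone fun s => φ s n) (ht : ∀ s, Antitone (φ s))
    (hlim : Filter.Tendsto (fun s => φ s 0) (𝓝 0) (𝓝 0)) (t : ℝ≥0) :
    Continuous fun s => envelope φ s t := by
  rw [continuous_iff_continuousAt]
  intro s
  rcases eq_or_lt_of_le (zero_le : 0 ≤ s) with rfl | h0
  · have hz : envelope φ 0 t = 0 :=
      le_antisymm (ciSup_le fun p => by simp [envelopeTerm, clamp_of_nonpos])
        (envelope_nonneg 0 t)
    rw [ContinuousAt, hz]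
    have h2 : Filter.Tendsto (fun s : ℝ≥0 => (φ (2 * s) 0 : ℝ)) (𝓝 0) (𝓝 0) :=
      NNReal.tendsto_coe.2 (hlim.comp
        (Continuous.tendsto' (continuous_const.mul continuous_id) 0 0 (mul_zero _)))
    refine squeeze_zero (fun s => envelope_nonneg s t) (fun s => ?_) h2
    refine (envelope_le hs ht s t).trans ?_
    exact_mod_cast ht _ (Nat.zero_le _)
  · rw [ContinuousAt, tendsto_iff_dist_tendsto_zero]
    have hne : (s : ℝ) ≠ 0 := by exact_mod_cast h0.ne'
    have h2 : Filter.Tendsto (fun s' : ℝ≥0 => (φ (2 * (2 * s)) 0 *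
        (2 * ((2 * s : ℝ≥0) : ℝ) * |(s' : ℝ)⁻¹ - (s : ℝ)⁻¹|) : ℝ)) (𝓝 s) (𝓝 0) := by
      have : ContinuousAt (fun s' : ℝ≥0 => (φ (2 * (2 * s)) 0 *
        (2 * ((2 * s : ℝ≥0) : ℝ) * |(s' : ℝ)⁻¹ - (s : ℝ)⁻¹|) : ℝ)) s := by
        have h3 : ContinuousAt (fun s' : ℝ≥0 => (s' : ℝ)⁻¹) s :=
          NNReal.continuous_coe.continuousAt.inv₀ hne
        fun_prop
      simpa [ContinuousAt] using this
    refine squeeze_zero' (Filter.Eventually.of_forall fun _ => dist_nonneg) ?_ h2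
    have hlt : s < 2 * s := by
      rw [two_mul]; exact lt_add_of_pos_left s h0
    filter_upwards [Ioo_mem_nhds h0 hlt] with s' hs'
    exact abs_envelope_sub_le hs ht t hs'.1 h0 hs'.2.le hlt.le

lemma tendsto_envelope (hs : ∀ n, Monotone fun s => φ s n) (ht : ∀ s, Antitone (φ s))
    (hlim : ∀ s, Filter.Tendsto (φ s) Filter.atTop (𝓝 0)) (s : ℝ≥0) :
    Filter.Tendsto (envelope φ s) Filter.atTop (𝓝 0) := by
  refine squeeze_zero (fun t => envelope_nonneg s t) (fun t => envelope_le hs ht s t) ?_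
  exact NNReal.tendsto_coe.2 ((hlim (2 * s)).comp tendsto_nat_floor_atTop)

end Envelope

/-- A function that is monotone in the first argument, antitone in the second, and has the limits
of a class-`𝓚𝓛` function is bounded by a class-`𝓚𝓛` function. -/
theorem exists_classKL_bound {φ : ℝ≥0 → ℕ → ℝ≥0} (hs : ∀ n, Monotone fun s => φ s n)
    (ht : ∀ s, Antitone (φ s)) (hlim0 : Filter.Tendsto (fun s => φ s 0) (𝓝 0) (𝓝 0))
    (hlim : ∀ s, Filter.Tendsto (φ s) Filter.atTop (𝓝 0)) :
    ∃ β : ℝ≥0 → ℝ≥0 → ℝ≥0, ClassKL β ∧ ∀ s (n : ℕ), φ s n ≤ β s n := by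
  have hφ0 : ∀ n, φ 0 n = 0 := fun n => by
    have h0 : φ 0 0 ≤ 0 := ge_of_tendsto hlim0
      (Filter.Eventually.of_forall fun s => hs 0 (zero_le : (0 : ℝ≥0) ≤ s))
    exact le_antisymm ((ht 0 (Nat.zero_le n)).trans h0) zero_le
  -- The envelope is only weakly monotone; the class-`𝓚𝓛` summand `s / (1 + t)` supplies strictness.
  refine ⟨fun s t => (envelope φ s t).toNNReal + s / (1 + t), ⟨fun t => ⟨?_, ?_, ?_⟩,
    fun s h0 => ⟨?_, ?_, ?_⟩⟩, fun s n => ?_⟩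
  · exact (continuous_real_toNNReal.comp (continuous_envelope_left hs ht hlim0 t)).add
      (continuous_id.div_const _)
  · refine Monotone.add_strictMono
      (fun s s' h => Real.toNNReal_mono (envelope_mono hs ht t h)) fun s s' h => ?_
    exact div_lt_div_of_pos_right h (by positivity)
  · have := envelope_le hs ht 0 t
    simp only [mul_zero, hφ0, NNReal.coe_zero] at this
    simp [Real.toNNReal_of_nonpos this]
  · refine (continuous_real_toNNReal.comp (continuous_envelope_right hs ht s)).add ?_
    exact continuous_const.div₀ (continuous_const.add continuous_id) fun t => by positivity
  · refine Antitone.add_strictAnti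
      (fun t t' h => Real.toNNReal_mono (envelope_anti hs ht s h)) fun t t' h => ?_
    exact div_lt_div_of_pos_left h0 (by positivity) (by gcongr)
  · have h1 : Filter.Tendsto (fun t => (envelope φ s t).toNNReal) Filter.atTop (𝓝 0) := by
      simpa using tendsto_real_toNNReal (tendsto_envelope hs ht hlim s)
    have h2 : Filter.Tendsto (fun t : ℝ≥0 => s / (1 + t)) Filter.atTop (𝓝 0) := by
      rw [← NNReal.tendsto_coe]
      simp only [NNReal.coe_div, NNReal.coe_add, NNReal.coe_one, NNReal.coe_zero]
      exact tendsto_const_nhds.div_atTop (Filter.tendsto_atTop_add_const_left _ _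
        (NNReal.tendsto_coe_atTop.2 Filter.tendsto_id))
    simpa using h1.add h2
  · rcases eq_or_lt_of_le (zero_le : 0 ≤ s) with rfl | h0
    · simp [hφ0]
    · exact (NNReal.le_toNNReal_of_coe_le (le_envelope hs ht h0 n)).trans le_self_add

/-! ### From ε–δ estimates to ISS. -/

lemma tendsto_nnreal_zero_of {ι : Type*} {l : Filter ι} {f : ι → ℝ≥0}
    (h : ∀ ε : ℝ≥0, 0 < ε → ∀ᶠ i in l, f i ≤ ε) : Filter.Tendsto f l (𝓝 0) :=
  tendsto_order.2 ⟨fun _ ha => absurd ha not_lt_zero, fun ε hε =>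
    (h (ε / 2) (half_pos hε)).mono fun _ hi => hi.trans_lt (half_lt_self_iff.2 hε)⟩

/-- Input-to-state stability follows from boundedness, stability and uniform attractivity up to
a common gain. -/
theorem IsISS.of_stable_of_attractive {X D : Type*} [NormedAddCommGroup X]
    [NormedAddCommGroup D] {F : X → D → X} {xe : X} {γ : ℝ≥0 → ℝ≥0} (hγ : ClassK γ)
    (hbdd : ∀ S : ℝ≥0, ∃ R : ℝ≥0, ∀ (x : ℕ → X) (d : ℕ → D), (∀ t, x (t + 1) = F (x t) (d t)) →
      BddAbove (Set.range fun t => ‖d t‖₊) → ‖x 0 - xe‖₊ ≤ S →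
      ∀ t, ‖x t - xe‖₊ ≤ R + γ (⨆ s, ‖d s‖₊))
    (hstab : ∀ ε : ℝ≥0, 0 < ε → ∃ δ : ℝ≥0, 0 < δ ∧ ∀ (x : ℕ → X) (d : ℕ → D),
      (∀ t, x (t + 1) = F (x t) (d t)) →
      BddAbove (Set.range fun t => ‖d t‖₊) → ‖x 0 - xe‖₊ ≤ δ →
      ∀ t, ‖x t - xe‖₊ ≤ ε + γ (⨆ s, ‖d s‖₊))
    (hattr : ∀ S ε : ℝ≥0, 0 < ε → ∃ N : ℕ, ∀ (x : ℕ → X) (d : ℕ → D),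
      (∀ t, x (t + 1) = F (x t) (d t)) →
      BddAbove (Set.range fun t => ‖d t‖₊) → ‖x 0 - xe‖₊ ≤ S →
      ∀ t, N ≤ t → ‖x t - xe‖₊ ≤ ε + γ (⨆ s, ‖d s‖₊)) :
    IsISS F xe := by
  -- Subtraction is truncated, so the excess is `0` where the gain alone suffices. Allowing all `t ≥
  -- N`, not just `t = N`, makes the supremum antitone in `N`.
  let E : ℝ≥0 → ℕ → Set ℝ≥0 := fun S N => {e | ∃ (x : ℕ → X) (d : ℕ → D),
    (∀ t, x (t + 1) = F (x t) (d t)) ∧ BddAbove (Set.range fun t => ‖d t‖₊) ∧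
    ‖x 0 - xe‖₊ ≤ S ∧ ∃ t, N ≤ t ∧ e = ‖x t - xe‖₊ - γ (⨆ s, ‖d s‖₊)}
  have hE : ∀ S N, BddAbove (E S N) := by
    intro S N
    obtain ⟨R, hR⟩ := hbdd S
    refine ⟨R, ?_⟩
    rintro _ ⟨x, d, hx, hd, h0, t, -, rfl⟩
    exact tsub_le_iff_right.2 (hR x d hx hd h0 t)
  obtain ⟨β, hβ, hle⟩ := exists_classKL_bound (φ := fun S N => sSup (E S N))
    (fun N S S' h => csSup_le_csSup' (hE S' N) (by
      rintro e ⟨x, d, hx, hd, h0, ht⟩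
      exact ⟨x, d, hx, hd, h0.trans h, ht⟩))
    (fun S N N' h => csSup_le_csSup' (hE S N) (by
      rintro e ⟨x, d, hx, hd, h0, t, ht, rfl⟩
      exact ⟨x, d, hx, hd, h0, t, h.trans ht, rfl⟩))
    (tendsto_nnreal_zero_of fun ε hε => by
      obtain ⟨δ, hδ, h⟩ := hstab ε hε
      filter_upwards [Iic_mem_nhds hδ] with S hS
      refine csSup_le' ?_
      rintro _ ⟨x, d, hx, hd, h0, t, -, rfl⟩
      exact tsub_le_iff_right.2 (h x d hx hd (h0.trans hS) t))
    (fun S => tendsto_nnreal_zero_of fun ε hε => by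
      obtain ⟨N, h⟩ := hattr S ε hε
      filter_upwards [Filter.eventually_ge_atTop N] with N' hN'
      refine csSup_le' ?_
      rintro _ ⟨x, d, hx, hd, h0, t, ht, rfl⟩
      exact tsub_le_iff_right.2 (h x d hx hd h0 t (hN'.trans ht)))
  refine ⟨β, γ, hβ, hγ, fun x d hx hd t => ?_⟩
  rw [← tsub_le_iff_right]
  exact (le_csSup (hE _ t) ⟨x, d, hx, hd, le_rfl, t, le_rfl, rfl⟩).trans (hle _ t)

/-! ### Descent of the cost under one controller step. -/

section Descent

variable {n : ℕ}

lemma fderiv_gradient_apply (J : EuclideanSpace ℝ (Fin n) → ℝ) (y v : EuclideanSpace ℝ (Fin n)) :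
    fderiv ℝ (gradient J) y v = WithLp.toLp 2 ((hessianMatrix J y).mulVec v.ofLp) := by
  ext i
  have hv : v = ∑ j, v j • EuclideanSpace.single j (1 : ℝ) := by
    simpa using ((EuclideanSpace.basisFun (Fin n) ℝ).sum_repr v).symm
  conv_lhs => rw [hv]
  simp [map_sum, hessianMatrix, Matrix.mulVec, dotProduct, mul_comm]

lemma contDiff_gradient {J : EuclideanSpace ℝ (Fin n) → ℝ} (hJ : ContDiff ℝ 2 J) :
    ContDiff ℝ 1 (gradient J) :=
  (InnerProductSpace.toDual ℝ (EuclideanSpace ℝ (Fin n))).symm.contDiff.comp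
    (hJ.fderiv_right (by norm_num))

/-- Second-order descent estimate along a direction `v` with curvature at most `q`. -/
lemma le_add_inner_gradient_add_half {J : EuclideanSpace ℝ (Fin n) → ℝ} (hJ : ContDiff ℝ 2 J)
    (r v : EuclideanSpace ℝ (Fin n)) {q : ℝ}
    (hq : ∀ y, inner ℝ (fderiv ℝ (gradient J) y v) v ≤ q) :
    J (r + v) ≤ J r + inner ℝ (gradient J r) v + q / 2 := by
  have hline : ∀ τ : ℝ, HasDerivAt (fun τ : ℝ => r + τ • v) v τ := fun τ => by
    simpa using ((hasDerivAt_id τ).smul_const v).const_add r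
  have hgrad : ∀ τ : ℝ, HasDerivAt (fun τ : ℝ => inner ℝ (gradient J (r + τ • v)) v)
      (inner ℝ (fderiv ℝ (gradient J) (r + τ • v) v) v) τ := fun τ => by
    have h1 := (((contDiff_gradient hJ).differentiable one_ne_zero
      (r + τ • v)).hasFDerivAt.comp_hasDerivAt τ (hline τ))
    simpa using h1.inner ℝ (hasDerivAt_const τ v)
  have hval : ∀ τ : ℝ, HasDerivAt (fun τ : ℝ => J (r + τ • v))
      (inner ℝ (gradient J (r + τ • v)) v) τ := fun τ => by
    have h1 := (hJ.differentiable two_ne_zero (r + τ • v)).hasGradientAt.hasFDerivAt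
    exact (h1.comp_hasDerivAt τ (hline τ)).congr_deriv (by simp)
  -- Taylor's formula without integrals: the curvature bound makes the slope minus `τ * q` antitone,
  -- and this in turn makes `J` minus its quadratic majorant antitone on `[0, 1]`.
  have hslope : ∀ τ : ℝ, 0 ≤ τ →
      inner ℝ (gradient J (r + τ • v)) v - τ * q ≤ inner ℝ (gradient J r) v := by
    have hd : ∀ τ : ℝ, HasDerivAt (fun τ : ℝ => inner ℝ (gradient J (r + τ • v)) v - τ * q)
        (inner ℝ (fderiv ℝ (gradient J) (r + τ • v) v) v - q) τ := fun τ => by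
      exact ((hgrad τ).sub ((hasDerivAt_id τ).mul_const q)).congr_deriv (by simp)
    have ha := antitone_of_hasDerivAt_nonpos hd fun τ => sub_nonpos.2 (hq _)
    intro τ hτ
    simpa using ha hτ
  have hd : ∀ τ : ℝ, HasDerivAt
      (fun τ : ℝ => J (r + τ • v) - τ * inner ℝ (gradient J r) v - τ ^ 2 * (q / 2))
      (inner ℝ (gradient J (r + τ • v)) v - inner ℝ (gradient J r) v - τ * q) τ := fun τ => by
    refine (((hval τ).sub ((hasDerivAt_id τ).mul_const (inner ℝ (gradient J r) v))).sub
      (((hasDerivAt_id τ).pow 2).mul_const (q / 2))).congr_deriv ?_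
    simp
    ring
  have ha : AntitoneOn (fun τ : ℝ => J (r + τ • v) - τ * inner ℝ (gradient J r) v
      - τ ^ 2 * (q / 2)) (Set.Icc 0 1) := by
    refine antitoneOn_of_hasDerivWithinAt_nonpos (convex_Icc 0 1)
      (fun τ _ => (hd τ).continuousAt.continuousWithinAt)
      (fun τ _ => (hd τ).hasDerivWithinAt) fun τ hτ => ?_
    rw [interior_Icc] at hτ
    linarith [hslope τ hτ.1.le]
  have := ha (Set.left_mem_Icc.2 zero_le_one) (Set.right_mem_Icc.2 zero_le_one) zero_le_one
  simp only [zero_smul, add_zero, one_smul] at this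
  linarith

/-- The gradient step with a gain `K` with `K - K (Hup + γ I) K ⪰ 0` decreases the cost. -/
lemma cost_controllerStep_le {J : EuclideanSpace ℝ (Fin n) → ℝ} (hJ : ContDiff ℝ 2 J)
    {K Hup : Matrix (Fin n) (Fin n) ℝ} (hHup : ∀ y, (Hup - hessianMatrix J y).PosSemidef)
    (hK : K.PosDef) {γ : ℝ} (hγ : 0 ≤ γ)
    (hgain : (K - K * (Hup + γ • (1 : Matrix (Fin n) (Fin n) ℝ)) * K).PosSemidef)
    {αmin : ℝ} (hαmin : αmin ≤ 1) (r : EuclideanSpace ℝ (Fin n)) :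
    J (controllerStep αmin 1 K (gradient J r) r) ≤ J r -
      (gradient J r).ofLp ⬝ᵥ K.mulVec (gradient J r).ofLp / 2 := by
  have hsymm : K.transpose = K := by
    rw [← Matrix.conjTranspose_eq_transpose_of_trivial, hK.isHermitian.eq]
  set w := (gradient J r).ofLp with hw
  rw [controllerStep, if_pos hαmin, one_smul]
  -- With `q = wᵀKw`, the second-order term costs at most half of the first-order decrease.
  have key := le_add_inner_gradient_add_half hJ r (-WithLp.toLp 2 (K.mulVec w))
    (q := w ⬝ᵥ K.mulVec w) fun y => by
      have h1 := (hHup y).dotProduct_mulVec_nonneg (K.mulVec w)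
      have h2 := hgain.dotProduct_mulVec_nonneg w
      have h3 : w ⬝ᵥ (K * (Hup + γ • (1 : Matrix (Fin n) (Fin n) ℝ)) * K).mulVec w =
          K.mulVec w ⬝ᵥ Hup.mulVec (K.mulVec w) + γ * (K.mulVec w ⬝ᵥ K.mulVec w) := by
        rw [← Matrix.mulVec_mulVec, ← Matrix.mulVec_mulVec, Matrix.dotProduct_mulVec w K,
          ← Matrix.mulVec_transpose, hsymm, Matrix.add_mulVec, dotProduct_add,
          Matrix.smul_mulVec, Matrix.one_mulVec, dotProduct_smul, smul_eq_mul]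
      have h4 : 0 ≤ γ * (K.mulVec w ⬝ᵥ K.mulVec w) :=
        mul_nonneg hγ (Finset.sum_nonneg fun i _ => mul_self_nonneg _)
      simp only [star_trivial, Matrix.sub_mulVec, dotProduct_sub] at h1 h2
      rw [map_neg, inner_neg_neg, fderiv_gradient_apply,
        EuclideanSpace.inner_eq_star_dotProduct]
      simp only [star_trivial]
      linarith
  refine key.trans_eq ?_
  rw [inner_neg_right, EuclideanSpace.inner_eq_star_dotProduct]
  simp only [star_trivial]
  rw [dotProduct_comm, ← hw]
  ring

/-- The constant is the minimum of the quadratic form on the compact unit sphere; homogeneity does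
the rest. The sphere is empty only for the trivial space. -/
lemma Matrix.PosDef.exists_pos_mul_sq_norm_le {K : Matrix (Fin n) (Fin n) ℝ} (hK : K.PosDef) :
    ∃ c : ℝ, 0 < c ∧ ∀ v : EuclideanSpace ℝ (Fin n), c * ‖v‖ ^ 2 ≤ v.ofLp ⬝ᵥ K.mulVec v.ofLp := by
  have hcont : Continuous fun v : EuclideanSpace ℝ (Fin n) => v.ofLp ⬝ᵥ K.mulVec v.ofLp := by
    have : Continuous fun v : EuclideanSpace ℝ (Fin n) => v.ofLp := PiLp.continuous_ofLp 2 _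
    exact this.dotProduct (continuous_const.matrix_mulVec this)
  rcases (Metric.sphere (0 : EuclideanSpace ℝ (Fin n)) 1).eq_empty_or_nonempty with h | h
  · refine ⟨1, one_pos, fun v => ?_⟩
    have hv : v = 0 := by
      by_contra hv
      have : (‖v‖⁻¹ : ℝ) • v ∈ Metric.sphere (0 : EuclideanSpace ℝ (Fin n)) 1 := by
        simp [norm_smul, norm_ne_zero_iff.2 hv]
      simp [h] at this
    simp [hv]
  obtain ⟨u, hu, hmin⟩ := (isCompact_sphere _ _).exists_isMinOn h hcont.continuousOn
  have hu0 : u.ofLp ≠ 0 := fun h0 => by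
    have : u = 0 := by ext i; exact congrFun h0 i
    simp [this] at hu
  refine ⟨u.ofLp ⬝ᵥ K.mulVec u.ofLp, by simpa using hK.dotProduct_mulVec_pos hu0, fun v => ?_⟩
  rcases eq_or_ne v 0 with rfl | hv
  · simp
  have hv' : ‖v‖ ≠ 0 := norm_ne_zero_iff.2 hv
  have h1 : (‖v‖⁻¹ : ℝ) • v ∈ Metric.sphere (0 : EuclideanSpace ℝ (Fin n)) 1 := by
    simp [norm_smul, hv']
  have h2 := isMinOn_iff.1 hmin _ h1
  simp only [WithLp.ofLp_smul, Matrix.mulVec_smul, dotProduct_smul, smul_dotProduct,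
    smul_eq_mul] at h2
  calc _ ≤ (‖v‖⁻¹ * (‖v‖⁻¹ * (v.ofLp ⬝ᵥ K.mulVec v.ofLp))) * ‖v‖ ^ 2 :=
        mul_le_mul_of_nonneg_right h2 (sq_nonneg _)
    _ = _ := by field_simp

end Descent

/-! ### Comparison functions. -/

lemma ClassK.exists_pos_le {α : ℝ≥0 → ℝ≥0} (hα : ClassK α) {ε : ℝ≥0} (hε : 0 < ε) :
    ∃ δ, 0 < δ ∧ α δ ≤ ε := by
  have h : ∀ᶠ s in 𝓝 0, α s ≤ ε := (hα.1.tendsto' 0 0 hα.2.2).eventually (Iic_mem_nhds hε)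
  obtain ⟨δ, h1, h2⟩ := ((h.filter_mono nhdsWithin_le_nhds).and
    (self_mem_nhdsWithin (s := Set.Ioi 0))).exists
  exact ⟨δ, h2, h1⟩

lemma ClassK.pos {α : ℝ≥0 → ℝ≥0} (hα : ClassK α) {s : ℝ≥0} (hs : 0 < s) : 0 < α s := by
  simpa [hα.2.2] using hα.2.1 hs

/-- A weak triangle inequality, from `a + b ≤ 2 * max a b`. -/
lemma ClassK.map_add_le {α : ℝ≥0 → ℝ≥0} (hα : ClassK α) (a b : ℝ≥0) :
    α (a + b) ≤ α (2 * a) + α (2 * b) := by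
  rcases le_total a b with h | h
  · refine (hα.2.1.monotone ?_).trans le_add_self
    rw [two_mul]
    gcongr
  · refine (hα.2.1.monotone ?_).trans le_self_add
    rw [two_mul]
    gcongr

lemma ClassK.comp {α α' : ℝ≥0 → ℝ≥0} (hα : ClassK α) (hα' : ClassK α') :
    ClassK fun s => α (α' s) :=
  ⟨hα.1.comp hα'.1, hα.2.1.comp hα'.2.1, by simp only [hα'.2.2, hα.2.2]⟩

lemma ClassK.add {α α' : ℝ≥0 → ℝ≥0} (hα : ClassK α) (hα' : ClassK α') :
    ClassK fun s => α s + α' s :=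
  ⟨hα.1.add hα'.1, hα.2.1.add hα'.2.1, by simp only [hα'.2.2, hα.2.2, add_zero]⟩

lemma classK_two_mul : ClassK fun s => 2 * s :=
  ⟨continuous_const.mul continuous_id, fun _ _ h => mul_lt_mul_of_pos_left h two_pos, mul_zero _⟩

lemma ClassKL.le_apply_zero {β : ℝ≥0 → ℝ≥0 → ℝ≥0} (hβ : ClassKL β) (s t : ℝ≥0) :
    β s t ≤ β s 0 := by
  rcases eq_or_lt_of_le (zero_le : 0 ≤ s) with rfl | h
  · exact ((hβ.1 t).2.2.trans (hβ.1 0).2.2.symm).le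
  · exact (hβ.2 s h).2.1.antitone zero_le

lemma ClassKL.tendsto_natCast {β : ℝ≥0 → ℝ≥0 → ℝ≥0} (hβ : ClassKL β) (s : ℝ≥0) :
    Filter.Tendsto (fun n : ℕ => β s n) Filter.atTop (𝓝 0) := by
  rcases eq_or_lt_of_le (zero_le : 0 ≤ s) with rfl | h
  · exact tendsto_const_nhds.congr fun n : ℕ => (hβ.1 n).2.2.symm
  · exact (hβ.2 s h).2.2.comp tendsto_natCast_atTop_atTop

/-! ### Lyapunov estimates uniform over trajectories. -/

section Lyapunov

/-- `V` is a Lyapunov function along a trajectory at distance `e k` from the equilibrium. -/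
structure IsLyapunovAlong (κ₁ κ₂ κ₃ : ℝ≥0 → ℝ≥0) (c : ℝ) (e : ℕ → ℝ≥0) (V : ℕ → ℝ) : Prop where
  lower : ∀ k, (κ₁ (e k) : ℝ) ≤ V k
  upper : ∀ k, V k ≤ κ₂ (e k)
  decrease : ∀ k, V (k + 1) ≤ V k - c * (κ₃ (e k) : ℝ) ^ 2

variable {κ₁ κ₂ κ₃ : ℝ≥0 → ℝ≥0} {c : ℝ} {e : ℕ → ℝ≥0} {V : ℕ → ℝ}

lemma IsLyapunovAlong.antitone (h : IsLyapunovAlong κ₁ κ₂ κ₃ c e V) (hc : 0 < c) :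
    Antitone V :=
  antitone_nat_of_succ_le fun k => (h.decrease k).trans
    (sub_le_self _ (mul_nonneg hc.le (sq_nonneg _)))

/-- Sublevel sets of `V` trap the trajectory: `κ₁ (e k) ≤ V k ≤ V N ≤ κ₂ (e N) ≤ κ₁ R`. A general
entry time `N` is needed for attractivity. -/
lemma IsLyapunovAlong.le_of_le (h : IsLyapunovAlong κ₁ κ₂ κ₃ c e V) (hc : 0 < c)
    (h₁ : ClassKInf κ₁) (h₂ : ClassKInf κ₂) {s R : ℝ≥0} (hs : κ₂ s ≤ κ₁ R) {N : ℕ} (h0 : e N ≤ s)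
    {k : ℕ} (hk : N ≤ k) : e k ≤ R := by
  have : κ₁ (e k) ≤ κ₁ R := by
    refine le_trans ?_ ((h₂.1.2.1.monotone h0).trans hs)
    exact_mod_cast (h.lower k).trans ((h.antitone hc hk).trans (h.upper N))
  exact h₁.1.2.1.le_iff_le.1 this

lemma IsLyapunovAlong.exists_bound (hc : 0 < c) (h₁ : ClassKInf κ₁) (h₂ : ClassKInf κ₂)
    (S : ℝ≥0) : ∃ R, ∀ e V, IsLyapunovAlong κ₁ κ₂ κ₃ c e V → e 0 ≤ S → ∀ k, e k ≤ R := by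
  obtain ⟨R, hR⟩ := (h₁.2.eventually (Filter.eventually_ge_atTop (κ₂ S))).exists
  exact ⟨R, fun e V h h0 k => h.le_of_le hc h₁ h₂ hR h0 (Nat.zero_le k)⟩

lemma IsLyapunovAlong.exists_stable (hc : 0 < c) (h₁ : ClassKInf κ₁) (h₂ : ClassKInf κ₂)
    {ε : ℝ≥0} (hε : 0 < ε) :
    ∃ δ, 0 < δ ∧ ∀ e V, IsLyapunovAlong κ₁ κ₂ κ₃ c e V → e 0 ≤ δ → ∀ k, e k ≤ ε := by
  obtain ⟨δ, hδ, hle⟩ := h₂.1.exists_pos_le (h₁.1.pos hε)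
  exact ⟨δ, hδ, fun e V h h0 k => h.le_of_le hc h₁ h₂ hle h0 (Nat.zero_le k)⟩

lemma IsLyapunovAlong.exists_attractive (hc : 0 < c) (h₁ : ClassKInf κ₁) (h₂ : ClassKInf κ₂)
    (h₃ : ClassKInf κ₃) (S : ℝ≥0) {ε : ℝ≥0} (hε : 0 < ε) :
    ∃ N : ℕ, ∀ e V, IsLyapunovAlong κ₁ κ₂ κ₃ c e V → e 0 ≤ S → ∀ k, N ≤ k → e k ≤ ε := by
  obtain ⟨δ, hδ, hle⟩ := h₂.1.exists_pos_le (h₁.1.pos hε)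
  have hpos : 0 < c * (κ₃ δ : ℝ) ^ 2 :=
    mul_pos hc (pow_pos (NNReal.coe_pos.2 (h₃.1.pos hδ)) 2)
  -- While `e > δ`, each step lowers `V` by at least `c * κ₃ δ ^ 2`; after `N` such steps from `V 0
  -- ≤ κ₂ S`, `V` would be negative.
  obtain ⟨N, hN⟩ := exists_nat_gt ((κ₂ S : ℝ) / (c * (κ₃ δ : ℝ) ^ 2))
  refine ⟨N, fun e V h h0 k hk => ?_⟩
  by_cases hex : ∃ j ≤ N, e j ≤ δ
  · obtain ⟨j, hj, hj'⟩ := hex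
    exact h.le_of_le hc h₁ h₂ hle hj' (hj.trans hk)
  exfalso
  push Not at hex
  have hV : ∀ j ≤ N, V j ≤ κ₂ S - j * (c * (κ₃ δ : ℝ) ^ 2) := by
    intro j
    induction j with
    | zero =>
      intro _
      have : (κ₂ (e 0) : ℝ) ≤ κ₂ S := by exact_mod_cast h₂.1.2.1.monotone h0
      simpa using (h.upper 0).trans this
    | succ j ih =>
      intro hj
      have h4 : (κ₃ δ : ℝ) ≤ κ₃ (e j) := by
        exact_mod_cast h₃.1.2.1.monotone (hex j (by omega)).le
      have h5 : c * (κ₃ δ : ℝ) ^ 2 ≤ c * (κ₃ (e j) : ℝ) ^ 2 := by gcongr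
      have h6 := h.decrease j
      have h7 := ih (by omega)
      push_cast
      linarith
  have h8 := hV N le_rfl
  rw [div_lt_iff₀ hpos] at hN
  have h9 := (NNReal.coe_nonneg _).trans (h.lower N)
  linarith

end Lyapunov

lemma exists_isLyapunovAlong {n : ℕ} {J : EuclideanSpace ℝ (Fin n) → ℝ}
    {Hlow Hup : Matrix (Fin n) (Fin n) ℝ} {ystar : EuclideanSpace ℝ (Fin n)}
    (hcost : CostAssumption J Hlow Hup ystar)
    {K : Matrix (Fin n) (Fin n) ℝ} (hK : K.PosDef) {γ : ℝ} (hγ : 0 ≤ γ)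
    (hgain : (K - K * (Hup + γ • (1 : Matrix (Fin n) (Fin n) ℝ)) * K).PosSemidef)
    {αmin : ℝ} (hαmin : αmin ≤ 1) :
    ∃ (κ₁ κ₂ κ₃ : ℝ≥0 → ℝ≥0) (c : ℝ), ClassKInf κ₁ ∧ ClassKInf κ₂ ∧ ClassKInf κ₃ ∧ 0 < c ∧
      ∀ r : ℕ → EuclideanSpace ℝ (Fin n),
        (∀ k, r (k + 1) = controllerStep αmin 1 K (gradient J (r k)) (r k)) →
        IsLyapunovAlong κ₁ κ₂ κ₃ c (fun k => ‖r k - ystar‖₊) (fun k => J (r k) - J ystar) := by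
  obtain ⟨κ₁, κ₂, h₁, h₂, hb⟩ := hcost.bounds
  obtain ⟨κ₃, h₃, hg⟩ := hcost.gradient_bound
  obtain ⟨c, hc, hcK⟩ := hK.exists_pos_mul_sq_norm_le
  refine ⟨κ₁, κ₂, κ₃, c / 2, h₁, h₂, h₃, half_pos hc, fun r hr =>
    ⟨fun k => (hb _).1, fun k => (hb _).2, fun k => ?_⟩⟩
  have hdec := cost_controllerStep_le hcost.contDiff hcost.curvature_upper hK hγ hgain hαmin (r k)
  rw [← hr k] at hdec
  have h4 : (κ₃ ‖r k - ystar‖₊ : ℝ) ≤ ‖gradient J (r k)‖ := by exact_mod_cast hg (r k)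
  have h5 : c * (κ₃ ‖r k - ystar‖₊ : ℝ) ^ 2 ≤ c * ‖gradient J (r k)‖ ^ 2 := by gcongr
  have h6 := hcK (gradient J (r k))
  linarith

/-! ### Cascades. -/

/-- Bound on the driven subsystem of a cascade from time `N` on. -/
lemma cascade_bound {X U : Type*} [NormedAddCommGroup X] [NormedAddCommGroup U]
    {f : X → U → X} {u : U} {xe : X} {β : ℝ≥0 → ℝ≥0 → ℝ≥0} {σ : ℝ≥0 → ℝ≥0}
    (hβ : ClassKL β) (hσ : ClassK σ)
    (hiss : ∀ (x : ℕ → X) (d : ℕ → U), (∀ t, x (t + 1) = f (x t) (u + d t)) →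
      BddAbove (Set.range fun t => ‖d t‖₊) →
        ∀ t : ℕ, ‖x t - xe‖₊ ≤ β ‖x 0 - xe‖₊ (t : ℝ≥0) + σ (⨆ s, ‖d s‖₊))
    {x : ℕ → X} {r d : ℕ → U} (hx : ∀ t, x (t + 1) = f (x t) (r t + d t))
    (hd : BddAbove (Set.range fun t => ‖d t‖₊)) {N : ℕ} {A E : ℝ≥0}
    (hr : ∀ k, N ≤ k → ‖r k - u‖₊ ≤ E) (hA : ‖x N - xe‖₊ ≤ A) (k : ℕ) :
    ‖x (N + k) - xe‖₊ ≤ β A k + σ (2 * E) + σ (2 * ⨆ s, ‖d s‖₊) := by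
  have hin : ∀ t, ‖r (N + t) + d (N + t) - u‖₊ ≤ E + ⨆ s, ‖d s‖₊ := fun t => by
    rw [add_sub_right_comm]
    exact (nnnorm_add_le _ _).trans
      (add_le_add (hr _ (Nat.le_add_right _ _)) (le_ciSup hd (N + t)))
  -- Restarted at time `N`, the plant sees the constant input `u` perturbed by `r + d - u`.
  have h := hiss (fun t => x (N + t)) (fun t => r (N + t) + d (N + t) - u)
    (fun t => by rw [add_sub_cancel, ← add_assoc]; exact hx (N + t))
    ⟨_, by rintro _ ⟨t, rfl⟩; exact hin t⟩ k
  refine h.trans ?_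
  rw [add_assoc]
  refine add_le_add ((hβ.1 k).2.1.monotone hA) ?_
  exact (hσ.2.1.monotone (ciSup_le hin)).trans (hσ.map_add_le _ _)

/-- The cascade of an input-to-state stable system, driven by an autonomous system with a Lyapunov
function, is input-to-state stable. -/
theorem IsISS.cascade {X U : Type*} [NormedAddCommGroup X] [NormedAddCommGroup U]
    {f : X → U → X} {h : U → U} {u : U} {xe : X} (hf : IsISS (fun x d => f x (u + d)) xe)
    {κ₁ κ₂ κ₃ : ℝ≥0 → ℝ≥0} {c : ℝ} (h₁ : ClassKInf κ₁) (h₂ : ClassKInf κ₂) (h₃ : ClassKInf κ₃)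
    (hc : 0 < c) {V : U → ℝ} (hlyap : ∀ r : ℕ → U, (∀ k, r (k + 1) = h (r k)) →
      IsLyapunovAlong κ₁ κ₂ κ₃ c (fun k => ‖r k - u‖₊) fun k => V (r k)) :
    IsISS (fun (z : WithLp 2 (X × U)) d => WithLp.toLp 2 (f z.fst (z.snd + d), h z.snd))
      (WithLp.toLp 2 (xe, u)) := by
  obtain ⟨β, σ, hβ, hσ, hiss⟩ := hf
  set ze : WithLp 2 (X × U) := WithLp.toLp 2 (xe, u)
  have hfst : ∀ z : WithLp 2 (X × U),
      ‖z.fst - xe‖₊ ≤ ‖z - ze‖₊ := fun z => WithLp.nnnorm_fst_le _ (z - ze)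
  have hsnd : ∀ z : WithLp 2 (X × U),
      ‖z.snd - u‖₊ ≤ ‖z - ze‖₊ := fun z => WithLp.nnnorm_snd_le _ (z - ze)
  have hadd : ∀ z : WithLp 2 (X × U),
      ‖z - ze‖₊ ≤ ‖z.fst - xe‖₊ + ‖z.snd - u‖₊ := fun z => by
    have h : ‖z - ze‖ ^ 2 = ‖z.fst - xe‖ ^ 2 + ‖z.snd - u‖ ^ 2 :=
      WithLp.prod_norm_sq_eq_of_L2 (z - ze)
    rw [← NNReal.coe_le_coe]
    push_cast
    refine abs_le_of_sq_le_sq' ?_ (by positivity) |>.2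
    rw [h]
    nlinarith [mul_nonneg (norm_nonneg (z.fst - xe)) (norm_nonneg (z.snd - u))]
  have hstate : ∀
      (z : ℕ → WithLp 2 (X × U))
      (d : ℕ → U),
      (∀ t, z (t + 1) = WithLp.toLp 2 (f (z t).fst ((z t).snd + d t), h (z t).snd)) →
      ∀ t, (z (t + 1)).fst = f (z t).fst ((z t).snd + d t) := fun z d hz t => by
    rw [hz t]; rfl
  have hctrl : ∀
      (z : ℕ → WithLp 2 (X × U))
      (d : ℕ → U),
      (∀ t, z (t + 1) = WithLp.toLp 2 (f (z t).fst ((z t).snd + d t), h (z t).snd)) →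
      IsLyapunovAlong κ₁ κ₂ κ₃ c (fun k => ‖(z k).snd - u‖₊)
        (fun k => V (z k).snd) := fun z d hz =>
    hlyap (fun k => (z k).snd) fun t => by rw [hz t]; rfl
  have hgainσ : ClassK fun s => σ (2 * s) := hσ.comp classK_two_mul
  -- The summand `σ (2 s)` is the direct effect of the dither. The summand `β (2 σ (2 s)) 0` is
  -- needed only for attractivity, where the restarted plant state already contains a dither
  -- contribution.
  refine IsISS.of_stable_of_attractive
    (hgainσ.add (((hβ.1 0).comp classK_two_mul).comp hgainσ)) ?_ ?_ ?_
  · intro S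
    obtain ⟨R, hR⟩ := IsLyapunovAlong.exists_bound (κ₃ := κ₃) hc h₁ h₂ S
    refine ⟨β S 0 + σ (2 * R) + R, fun z d hz hd h0 t => ?_⟩
    have hr := hR _ _ (hctrl z d hz) ((hsnd _).trans h0)
    have hx := cascade_bound hβ hσ hiss
      (x := fun t => (z t).fst) (r := fun t => (z t).snd) (hstate z d hz) hd (N := 0) (fun k _ => hr k)
      ((hfst _).trans h0) t
    rw [zero_add] at hx
    refine (hadd _).trans ((add_le_add hx (hr t)).trans ?_)
    have h4 := hβ.le_apply_zero S t
    calc β S t + σ (2 * R) + σ (2 * ⨆ s, ‖d s‖₊) + R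
        ≤ β S 0 + σ (2 * R) + σ (2 * ⨆ s, ‖d s‖₊) + R := by gcongr
      _ = β S 0 + σ (2 * R) + R + σ (2 * ⨆ s, ‖d s‖₊) := by ring
      _ ≤ _ := add_le_add le_rfl le_self_add
  · intro ε hε
    have hε3 : 0 < ε / 3 := div_pos hε three_pos
    obtain ⟨δ₁, hδ₁, hβδ⟩ := (hβ.1 0).exists_pos_le hε3
    obtain ⟨η, hη, hση⟩ := hgainσ.exists_pos_le hε3
    -- The bound `η` controls the effect of `r` on the plant, `ε / 3` its own share of the norm.
    obtain ⟨δ₂, hδ₂, hδr⟩ := IsLyapunovAlong.exists_stable (κ₃ := κ₃) hc h₁ h₂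
      (lt_min hη hε3)
    refine ⟨min δ₁ δ₂, lt_min hδ₁ hδ₂, fun z d hz hd h0 t => ?_⟩
    have hr := hδr _ _ (hctrl z d hz) ((hsnd _).trans (h0.trans (min_le_right _ _)))
    have hx := cascade_bound hβ hσ hiss
      (x := fun t => (z t).fst) (r := fun t => (z t).snd) (hstate z d hz) hd (N := 0)
      (fun k _ => (hr k).trans (min_le_left _ _)) ((hfst _).trans (h0.trans (min_le_left _ _))) t
    rw [zero_add] at hx
    refine (hadd _).trans ((add_le_add hx ((hr t).trans (min_le_right _ _))).trans ?_)
    have h4 := (hβ.le_apply_zero δ₁ t).trans hβδ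
    calc β δ₁ t + σ (2 * η) + σ (2 * ⨆ s, ‖d s‖₊) + ε / 3
        ≤ ε / 3 + ε / 3 + σ (2 * ⨆ s, ‖d s‖₊) + ε / 3 := by gcongr
      _ = ε + σ (2 * ⨆ s, ‖d s‖₊) := by
        rw [add_right_comm, add_thirds]
      _ ≤ _ := add_le_add le_rfl le_self_add
  · intro S ε hε
    have hε3 : 0 < ε / 3 := div_pos hε three_pos
    obtain ⟨R, hR⟩ := IsLyapunovAlong.exists_bound (κ₃ := κ₃) hc h₁ h₂ S
    obtain ⟨η, hη, hση⟩ := hgainσ.exists_pos_le hε3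
    obtain ⟨N₁, hN₁⟩ := IsLyapunovAlong.exists_attractive hc h₁ h₂ h₃ S (lt_min hη hε3)
    -- After `N₁` steps `r` is close to `u`; `N₂` more let the plant forget the part of its state at
    -- `N₁` that does not depend on the dither.
    obtain ⟨N₂, hN₂⟩ := Filter.eventually_atTop.1 ((hβ.tendsto_natCast
      (2 * (β S 0 + σ (2 * R)))).eventually (Iic_mem_nhds hε3))
    refine ⟨N₁ + N₂, fun z d hz hd h0 t ht => ?_⟩
    have hr0 := hR _ _ (hctrl z d hz) ((hsnd _).trans h0)
    have hr := hN₁ _ _ (hctrl z d hz) ((hsnd _).trans h0)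
    have hx0 := cascade_bound hβ hσ hiss
      (x := fun t => (z t).fst) (r := fun t => (z t).snd) (hstate z d hz) hd (N := 0) (fun k _ => hr0 k)
      ((hfst _).trans h0) N₁
    rw [zero_add] at hx0
    obtain ⟨k, rfl⟩ := Nat.exists_eq_add_of_le ((Nat.le_add_right _ _).trans ht)
    have hx := cascade_bound hβ hσ hiss
      (x := fun t => (z t).fst) (r := fun t => (z t).snd) (hstate z d hz) hd
      (fun j hj => (hr j hj).trans (min_le_left _ _))
      (hx0.trans (add_le_add_left (add_le_add_left (hβ.le_apply_zero S N₁) _) _)) k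
    refine (hadd _).trans ((add_le_add hx
      ((hr _ (Nat.le_add_right _ _)).trans (min_le_right _ _))).trans ?_)
    -- The dither part of the restart state is not bounded in terms of `S`, so it is split off and
    -- charged to the gain.
    have h4 := (hβ.1 k).map_add_le (β S 0 + σ (2 * R)) (σ (2 * ⨆ s, ‖d s‖₊))
    have h5 : β (2 * (β S 0 + σ (2 * R))) k ≤ ε / 3 := hN₂ k (by omega)
    have h6 := hβ.le_apply_zero (2 * σ (2 * ⨆ s, ‖d s‖₊)) k
    calc β (β S 0 + σ (2 * R) + σ (2 * ⨆ s, ‖d s‖₊)) k + σ (2 * η) +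
          σ (2 * ⨆ s, ‖d s‖₊) + ε / 3
        ≤ (ε / 3 + β (2 * σ (2 * ⨆ s, ‖d s‖₊)) 0) + ε / 3 + σ (2 * ⨆ s, ‖d s‖₊) + ε / 3 := by
          gcongr
          exact h4.trans (add_le_add h5 h6)
      _ = (ε / 3 + ε / 3 + ε / 3) +
          (σ (2 * ⨆ s, ‖d s‖₊) + β (2 * σ (2 * ⨆ s, ‖d s‖₊)) 0) := by ring
      _ = _ := by rw [add_thirds]

/-! ### The closed loop. -/

theorem mainTheorem5 {m n : ℕ}
    (f : EuclideanSpace ℝ (Fin m) → EuclideanSpace ℝ (Fin n) → EuclideanSpace ℝ (Fin m))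
    (g : EuclideanSpace ℝ (Fin m) → EuclideanSpace ℝ (Fin n) → EuclideanSpace ℝ (Fin n))
    (π : EuclideanSpace ℝ (Fin n) → EuclideanSpace ℝ (Fin m))
    (hplant : PlantAssumption f g π)
    (J : EuclideanSpace ℝ (Fin n) → ℝ) (Hlow Hup : Matrix (Fin n) (Fin n) ℝ)
    (ystar ustar : EuclideanSpace ℝ (Fin n)) (xstar : EuclideanSpace ℝ (Fin m))
    (hopt : IsOptimalEquilibrium f g J ystar ustar xstar)
    (hcost : CostAssumption J Hlow Hup ystar)
    (K : Matrix (Fin n) (Fin n) ℝ) (hK : K.PosDef)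
    (γ : ℝ) (hγ : 0 ≤ γ)
    (hgain : (K - K * (Hup + γ • (1 : Matrix (Fin n) (Fin n) ℝ)) * K).PosSemidef)
    (αmin : ℝ) (hαmin : αmin ≤ 1) :
    IsISS (closedLoop f J αmin K) (WithLp.toLp 2 (xstar, ustar)) := by
  obtain ⟨hxeq, hyeq, -⟩ := hopt
  -- Tracking along the constant trajectory at `xstar` forces the output there to equal the input.
  obtain rfl : ystar = ustar := by
    have := hplant.tracking ustar (fun _ => xstar) fun _ => hxeq
    rw [hyeq]
    exact tendsto_nhds_unique tendsto_const_nhds this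
  obtain rfl : xstar = π ystar := hplant.unique _ _ hxeq.symm
  obtain ⟨κ₁, κ₂, κ₃, c, h₁, h₂, h₃, hc, hlyap⟩ :=
    exists_isLyapunovAlong hcost hK hγ hgain hαmin
  exact (hplant.iss ystar).cascade (h := fun r => controllerStep αmin 1 K (gradient J r) r)
    (V := fun y => J y - J ystar) h₁ h₂ h₃ hc hlyap
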